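/- For a real number $s$ and an integer $n\ge 1$, let $Z_{s,n}$ be the Zipf distribution on $\{1,\dots,n\}$, given by $Z_{s,n}(j)=\dfrac{1}{j^{s}\sum_{i=1}^{n}i^{-s}}$, and let $Q_n$ be the Harmonic($n$) distribution on $\{1,\dots,n\}$, given by $Q_n(j)=\dfrac{1}{j\sum_{i=1}^{n}i^{-1}}$. Let $\omega(m)$ denote the number of distinct prime factors of $m$, and let $Z$ be a standard normal variable. (i) For every fixed $n\ge 1$, $Z_{s,n}$ converges in distribution to $Q_n$ as $s\to 1$. (ii) If $s$ is sufficiently close to $1$, depending on $n$, then the number of distinct prime factors of a Zipf$(n,s)$ random integer is asymptotically $\mathcal N(\log\log n,\log\log n)$ as $n\to\infty$. That is, there are numbers $\delta_n>0$ such that for every sequence of real numbers $(s_n)$ with $|s_n-1|<\delta_n$ for all sufficiently large $n$, and for every real $x$, $$Z_{s_n,n}\bigl(\{m\le n:\ \omega(m)-\log\log n\le x\,(\log\log n)^{1/2}\}\bigr)\longrightarrow \mathbb P(Z\le x)\qquad (n\to\infty).$$ -/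

import Mathlib

open MeasureTheory ProbabilityTheory Filter Topology

noncomputable section

/-- The Zipf mass function with parameters `n` and `s`:
`Z_{s,n}(j) = 1 / (j ^ s * ∑_{i = 1}^{n} 1 / i ^ s)`, for `j ∈ {1, …, n}`. -/
def zipfMass (s : ℝ) (n j : ℕ) : ℝ :=
  1 / ((j : ℝ) ^ s * ∑ i ∈ Finset.Icc 1 n, 1 / (i : ℝ) ^ s)

/-- The Harmonic(`n`) mass function:
`Q_n(j) = 1 / (j * ∑_{i = 1}^{n} 1 / i)`, for `j ∈ {1, …, n}`. -/
def harmonicMass (n j : ℕ) : ℝ :=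
  1 / ((j : ℝ) * ∑ i ∈ Finset.Icc 1 n, 1 / (i : ℝ))

/-- The measure on `ℕ` carried by `{1, …, n}` that gives the point `j` the mass `w j`. -/
def measureOnInitial (n : ℕ) (w : ℕ → ℝ) : Measure ℕ :=
  ∑ j ∈ Finset.Icc 1 n, ENNReal.ofReal (w j) • Measure.dirac j

/-- The Zipf distribution with parameters `n` and `s`, as a measure on `ℕ`. -/
def zipfMeasure (s : ℝ) (n : ℕ) : Measure ℕ := measureOnInitial n (zipfMass s n)

/-- The Harmonic(`n`) distribution, as a measure on `ℕ`. -/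
def harmonicMeasure (n : ℕ) : Measure ℕ := measureOnInitial n (harmonicMass n)

theorem zipfMass_nonneg (s : ℝ) (n j : ℕ) : 0 ≤ zipfMass s n j := by
  unfold zipfMass
  positivity

theorem harmonicMass_eq_zipfMass (n j : ℕ) : harmonicMass n j = zipfMass 1 n j := by
  simp [harmonicMass, zipfMass]

theorem harmonicMeasure_eq_zipfMeasure (n : ℕ) : harmonicMeasure n = zipfMeasure 1 n := by
  unfold harmonicMeasure zipfMeasure
  congr 1
  funext j
  exact harmonicMass_eq_zipfMass n j

theorem sum_zipfMass (s : ℝ) (n : ℕ) (hn : n ≠ 0) :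
    ∑ j ∈ Finset.Icc 1 n, zipfMass s n j = 1 := by
  have hpos : 0 < ∑ i ∈ Finset.Icc 1 n, 1 / (i : ℝ) ^ s := by
    apply Finset.sum_pos
    · intro i hi
      have h1 : 0 < i := (Finset.mem_Icc.mp hi).1
      positivity
    · exact ⟨1, Finset.mem_Icc.mpr ⟨le_refl 1, Nat.one_le_iff_ne_zero.mpr hn⟩⟩
  have h : ∀ j ∈ Finset.Icc 1 n, zipfMass s n j =
      (1 / (j : ℝ) ^ s) * (∑ i ∈ Finset.Icc 1 n, 1 / (i : ℝ) ^ s)⁻¹ := by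
    intro j _
    rw [zipfMass, one_div, mul_inv, one_div]
  rw [Finset.sum_congr rfl h, ← Finset.sum_mul, mul_inv_cancel₀ hpos.ne']

instance zipfMeasure_isProbabilityMeasure (s : ℝ) (n : ℕ) [NeZero n] :
    IsProbabilityMeasure (zipfMeasure s n) := by
  constructor
  have h : zipfMeasure s n Set.univ = ∑ j ∈ Finset.Icc 1 n, ENNReal.ofReal (zipfMass s n j) := by
    simp [zipfMeasure, measureOnInitial, Measure.finsetSum_apply]
  rw [h, ← ENNReal.ofReal_sum_of_nonneg (fun j _ => zipfMass_nonneg s n j),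
    sum_zipfMass s n (NeZero.ne n), ENNReal.ofReal_one]

instance harmonicMeasure_isProbabilityMeasure (n : ℕ) [NeZero n] :
    IsProbabilityMeasure (harmonicMeasure n) := by
  rw [harmonicMeasure_eq_zipfMeasure]
  infer_instance

/-- The Zipf distribution with parameters `n ≥ 1` and `s`, as a probability measure. -/
def zipfDist (s : ℝ) (n : ℕ) [NeZero n] : ProbabilityMeasure ℕ := ⟨zipfMeasure s n, inferInstance⟩

/-- The Harmonic(`n`) distribution, `n ≥ 1`, as a probability measure. -/
def harmonicDist (n : ℕ) [NeZero n] : ProbabilityMeasure ℕ := ⟨harmonicMeasure n, inferInstance⟩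

end

/-! For fixed n each Zipf mass is continuous in s, which gives (i) and lets δ_n be chosen so small
that the Zipf law is within 1/(n+1) of the harmonic law in ℓ¹. Part (ii) is thus Erdős–Kac for the
harmonic law (`tendsto_harmonic_cardDistinctFactors`).

Under the zeta law with exponent s > 1, divisibility by distinct primes is independent, with
probabilities p^(-s). So ω is a sum of independent Bernoulli variables, nearly Poisson with mean ∑
p^(-s) = log ζ(s) + O(1) (`norm_euler_sub_exp_le`, `abs_primeZetaSum_sub_log_zetaSum_le`). For s = 1
+ k/log n that mean is log log n + O(1), and characteristic functions give the central limit theorem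
(`tendsto_zetaLaw_cardDistinctFactors`).

The passage to the weights 1/m on m ≤ n is Karamata's Tauberian argument with a set A_n varying with
n. With σ = 1/log n, the variable m^(-σ) under the mass σ m^(-(1+σ)) on A_n has its moments governed
by the zeta laws with k = 1, 2, …. They tend to those of c times Lebesgue measure on [0, 1], and
integrating y⁻¹ over y ≥ 1/e recovers the logarithmic density
(`tendsto_logarithmic_density_of_zetaLaw`). -/

/-! ### Euler products and Poisson approximation -/

/-- The sum `∑ m ^ (-s)` as a real function of `s`. -/
noncomputable def zetaSum (s : ℝ) : ℝ := ∑' m : ℕ, 1 / (m : ℝ) ^ s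

/-- The sum `∑ p ^ (-s)` over the primes. -/
noncomputable def primeZetaSum (s : ℝ) : ℝ := ∑' p : Nat.Primes, 1 / (p : ℝ) ^ s

/-- Factors are exchanged one at a time; the others lie in the unit disc and do not enlarge the
error. -/
theorem norm_prod_sub_prod_le_sum {ι : Type*} (S : Finset ι) (a b : ι → ℂ) (c : ι → ℝ)
    (ha : ∀ i, ‖a i‖ ≤ 1) (hb : ∀ i, ‖b i‖ ≤ 1) (hc : ∀ i, ‖a i - b i‖ ≤ c i) :
    ‖∏ i ∈ S, a i - ∏ i ∈ S, b i‖ ≤ ∑ i ∈ S, c i := by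
  classical
  induction S using Finset.induction_on with
  | empty => simp
  | insert j S hj ih =>
    rw [Finset.prod_insert hj, Finset.prod_insert hj, Finset.sum_insert hj]
    have hB : ‖∏ i ∈ S, b i‖ ≤ 1 := by
      rw [norm_prod]
      exact Finset.prod_le_one (fun i _ => norm_nonneg _) (fun i _ => hb i)
    have e : a j * ∏ i ∈ S, a i - b j * ∏ i ∈ S, b i =
        (a j - b j) * ∏ i ∈ S, b i + a j * (∏ i ∈ S, a i - ∏ i ∈ S, b i) := by ring
    rw [e]
    refine (norm_add_le _ _).trans (add_le_add ?_ ?_)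
    · rw [norm_mul]
      exact (mul_le_of_le_one_right (norm_nonneg _) hB).trans (hc j)
    · rw [norm_mul]
      exact (mul_le_of_le_one_left (norm_nonneg _) (ha j)).trans ih

theorem summable_one_div_primes_rpow {s : ℝ} (hs : 1 < s) :
    Summable fun p : Nat.Primes => 1 / (p : ℝ) ^ s :=
  (Real.summable_one_div_nat_rpow.mpr hs).comp_injective Subtype.val_injective

theorem one_div_prime_rpow_pos (p : Nat.Primes) (s : ℝ) : 0 < 1 / (p : ℝ) ^ s := by
  have : (0 : ℝ) < p := by exact_mod_cast p.2.pos
  positivity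

theorem one_div_prime_rpow_le_half {s : ℝ} (hs : 1 < s) (p : Nat.Primes) :
    1 / (p : ℝ) ^ s ≤ 1 / 2 := by
  have h2 : (2 : ℝ) ≤ p := by exact_mod_cast p.2.two_le
  have h : (p : ℝ) ^ (1 : ℝ) ≤ (p : ℝ) ^ s :=
    Real.rpow_le_rpow_of_exponent_le (by linarith) hs.le
  rw [Real.rpow_one] at h
  exact one_div_le_one_div_of_le two_pos (h2.trans h)

/-- Makes every second-order error summable over the primes, uniformly as s decreases to 1. -/
theorem one_div_prime_rpow_sq_le {s : ℝ} (hs : 1 < s) (p : Nat.Primes) :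
    (1 / (p : ℝ) ^ s) ^ 2 ≤ 1 / (p : ℝ) ^ (2 : ℝ) := by
  have h2 : (2 : ℝ) ≤ p := by exact_mod_cast p.2.two_le
  have h : (p : ℝ) ^ (1 : ℝ) ≤ (p : ℝ) ^ s :=
    Real.rpow_le_rpow_of_exponent_le (by linarith) hs.le
  rw [Real.rpow_one] at h
  rw [div_pow, one_pow, Real.rpow_two]
  exact one_div_le_one_div_of_le (by positivity) (pow_le_pow_left₀ (by linarith) h 2)

theorem hasProd_euler_pow_cardDistinctFactors {s : ℝ} (hs : 1 < s) {z : ℂ} (hz : ‖z‖ ≤ 1) :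
    HasProd (fun p : Nat.Primes =>
        1 + z * ((1 / (p : ℝ) ^ s : ℝ) : ℂ) * (1 - ((1 / (p : ℝ) ^ s : ℝ) : ℂ))⁻¹)
      (∑' m : ℕ, ((1 / (m : ℝ) ^ s : ℝ) : ℂ) * z ^ ArithmeticFunction.cardDistinctFactors m) := by
  set f : ℕ → ℂ := fun m =>
    ((1 / (m : ℝ) ^ s : ℝ) : ℂ) * z ^ ArithmeticFunction.cardDistinctFactors m with hf
  have hs0 : s ≠ 0 := by linarith
  have h1 : f 1 = 1 := by simp [hf]
  -- Division by zero makes the weight at 0 vanish, so sums over `ℕ` run over the positive integers.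
  have h0 : f 0 = 0 := by simp [hf, Real.zero_rpow hs0]
  have hmul : ∀ {m n : ℕ}, m.Coprime n → f (m * n) = f m * f n := by
    intro m n h
    simp only [hf, ArithmeticFunction.cardDistinctFactors_mul h, Nat.cast_mul, pow_add,
      Real.mul_rpow (Nat.cast_nonneg m) (Nat.cast_nonneg n)]
    push_cast
    ring
  have hsum : Summable (‖f ·‖) := by
    refine Summable.of_nonneg_of_le (fun _ => norm_nonneg _) (fun m => ?_)
      (Real.summable_one_div_nat_rpow.mpr hs)
    simp only [hf, norm_mul, norm_pow, Complex.norm_real]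
    rw [Real.norm_of_nonneg (by positivity)]
    exact mul_le_of_le_one_right (by positivity) (pow_le_one₀ (norm_nonneg _) hz)
  have key := EulerProduct.eulerProduct_hasProd h1 hmul hsum h0
  convert! key using 2 with p
  set x : ℂ := ((1 / (p : ℝ) ^ s : ℝ) : ℂ) with hx
  have hxn : ‖x‖ < 1 := by
    rw [hx, Complex.norm_real, Real.norm_of_nonneg (one_div_prime_rpow_pos p s).le]
    linarith [one_div_prime_rpow_le_half hs p]
  have hpow : ∀ e : ℕ, f ((p : ℕ) ^ (e + 1)) = z * x * x ^ e := by
    intro e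
    simp only [hf, ArithmeticFunction.cardDistinctFactors_apply_prime_pow p.2 e.succ_ne_zero,
      pow_one]
    have : (((p : ℕ) ^ (e + 1) : ℕ) : ℝ) ^ s = ((p : ℝ) ^ s) ^ (e + 1) := by
      rw [Nat.cast_pow, ← Real.rpow_natCast, ← Real.rpow_mul (Nat.cast_nonneg _), mul_comm,
        Real.rpow_mul (Nat.cast_nonneg _), Real.rpow_natCast]
    rw [this, hx]
    push_cast
    ring
  have hse : Summable fun e : ℕ => f ((p : ℕ) ^ e) :=
    hsum.of_norm.comp_injective (Nat.pow_right_injective p.2.two_le)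
  rw [hse.tsum_eq_zero_add, pow_zero, h1, tsum_congr hpow, tsum_mul_left,
    tsum_geometric_of_norm_lt_one hxn]

theorem hasProd_zetaSum {s : ℝ} (hs : 1 < s) :
    HasProd (fun p : Nat.Primes => (1 - ((1 / (p : ℝ) ^ s : ℝ) : ℂ))⁻¹) (zetaSum s : ℂ) := by
  have h := hasProd_euler_pow_cardDistinctFactors hs (z := 1) (by simp)
  simp only [one_pow, mul_one, one_mul] at h
  rw [← Complex.ofReal_tsum] at h
  convert! h using 2 with p
  have h2 : (1 - ((1 / (p : ℝ) ^ s : ℝ) : ℂ)) ≠ 0 := by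
    have := one_div_prime_rpow_le_half hs p
    exact_mod_cast (show 1 - 1 / (p : ℝ) ^ s ≠ 0 by linarith)
  field_simp
  ring

theorem zetaSum_pos {s : ℝ} (hs : 1 < s) : 0 < zetaSum s := by
  have := (Real.summable_one_div_nat_rpow.mpr hs).le_tsum 1 (fun j _ => by positivity)
  simp only [Nat.cast_one, Real.one_rpow, div_one] at this
  exact lt_of_lt_of_le one_pos this

/-- With x = p^(-s), the quotient of the two Euler products has local factor 1 - x + zx, the
generating function of a Bernoulli variable. Replacing it by the Poisson factor exp((z - 1)x) costs
at most ‖z - 1‖² x². -/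
theorem norm_euler_sub_exp_le {s : ℝ} (hs : 1 < s) {z : ℂ} (hz : ‖z‖ = 1) :
    ‖(∑' m : ℕ, ((1 / (m : ℝ) ^ s : ℝ) : ℂ) * z ^ ArithmeticFunction.cardDistinctFactors m) /
        zetaSum s - Complex.exp ((z - 1) * primeZetaSum s)‖ ≤
      ‖z - 1‖ ^ 2 * primeZetaSum 2 := by
  set x : Nat.Primes → ℝ := fun p => 1 / (p : ℝ) ^ s with hx
  have hx0 : ∀ p, 0 < x p := fun p => one_div_prime_rpow_pos p s
  have hx2 : ∀ p, x p ≤ 1 / 2 := fun p => one_div_prime_rpow_le_half hs p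
  have hz2 : ‖z - 1‖ ≤ 2 := (norm_sub_le _ _).trans (by rw [hz]; norm_num)
  have hzre : z.re ≤ 1 := (Complex.re_le_norm z).trans hz.le
  have hZ : (zetaSum s : ℂ) ≠ 0 := by exact_mod_cast (zetaSum_pos hs).ne'
  have hA : HasProd (fun p => 1 - (x p : ℂ) + z * x p)
      ((∑' m : ℕ, ((1 / (m : ℝ) ^ s : ℝ) : ℂ) * z ^ ArithmeticFunction.cardDistinctFactors m) /
        zetaSum s) := by
    have h1 := Tendsto.div (hasProd_euler_pow_cardDistinctFactors hs hz.le) (hasProd_zetaSum hs) hZ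
    refine h1.congr fun S => ?_
    refine (Finset.prod_div_distrib _ _).symm.trans (Finset.prod_congr rfl fun p _ => ?_)
    have h2 : (1 - (x p : ℂ)) ≠ 0 := by
      exact_mod_cast (show 1 - x p ≠ 0 by linarith [hx2 p])
    change (1 + z * (x p : ℂ) * (1 - (x p : ℂ))⁻¹) / (1 - (x p : ℂ))⁻¹ = _
    field_simp
  have hB : HasProd (fun p => Complex.exp ((z - 1) * x p))
      (Complex.exp ((z - 1) * primeZetaSum s)) := by
    have h1 : HasSum (fun p => (z - 1) * (x p : ℂ)) ((z - 1) * primeZetaSum s) := by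
      refine HasSum.mul_left _ ?_
      exact_mod_cast (summable_one_div_primes_rpow hs).hasSum
    exact h1.cexp
  have hC : HasSum (fun p : Nat.Primes => ‖z - 1‖ ^ 2 * (1 / (p : ℝ) ^ (2 : ℝ)))
      (‖z - 1‖ ^ 2 * primeZetaSum 2) :=
    (summable_one_div_primes_rpow one_lt_two).hasSum.mul_left _
  refine le_of_tendsto (Tendsto.norm (Tendsto.sub hA hB)) (Eventually.of_forall fun S => ?_)
  refine (norm_prod_sub_prod_le_sum S _ _ (fun p => ‖z - 1‖ ^ 2 * (1 / (p : ℝ) ^ (2 : ℝ)))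
    ?_ ?_ ?_).trans (sum_le_hasSum S (fun p _ => by positivity) hC)
  · intro p
    have h3 : ‖(1 - (x p : ℂ))‖ = 1 - x p := by
      rw [← Complex.ofReal_one, ← Complex.ofReal_sub, Complex.norm_real,
        Real.norm_of_nonneg (by linarith [hx2 p])]
    refine (norm_add_le _ _).trans ?_
    rw [h3, norm_mul, hz, Complex.norm_real, Real.norm_of_nonneg (hx0 p).le]
    linarith
  · intro p
    rw [Complex.norm_exp, Complex.re_mul_ofReal, Real.exp_le_one_iff]
    refine mul_nonpos_of_nonpos_of_nonneg ?_ (hx0 p).le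
    simpa using hzre
  · intro p
    have hn : ‖(z - 1) * (x p : ℂ)‖ = ‖z - 1‖ * x p := by
      rw [norm_mul, Complex.norm_real, Real.norm_of_nonneg (hx0 p).le]
    -- The quadratic bound for exp needs its argument in the unit disc: ‖z - 1‖ ≤ 2 and x ≤ 1/2
    -- suffice.
    have h4 : ‖(z - 1) * (x p : ℂ)‖ ≤ 1 := by
      rw [hn]
      nlinarith [hx0 p, hx2 p, norm_nonneg (z - 1)]
    have h5 := Complex.norm_exp_sub_one_sub_id_le h4
    rw [← norm_neg] at h5
    have e : 1 - (x p : ℂ) + z * x p - Complex.exp ((z - 1) * x p) =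
        -(Complex.exp ((z - 1) * x p) - 1 - (z - 1) * x p) := by ring
    rw [e]
    refine h5.trans ?_
    rw [hn, mul_pow]
    exact mul_le_mul_of_nonneg_left (one_div_prime_rpow_sq_le hs p) (by positivity)

/-- Multiply exp(x) ≤ (1 - x)⁻¹ ≤ exp(x + 2x²), valid for 0 ≤ x ≤ 1/2, over the primes. -/
theorem abs_primeZetaSum_sub_log_zetaSum_le {s : ℝ} (hs : 1 < s) :
    |primeZetaSum s - Real.log (zetaSum s)| ≤ 2 * primeZetaSum 2 := by
  set x : Nat.Primes → ℝ := fun p => 1 / (p : ℝ) ^ s with hx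
  have hx0 : ∀ p, 0 < x p := fun p => one_div_prime_rpow_pos p s
  have hx2 : ∀ p, x p ≤ 1 / 2 := fun p => one_div_prime_rpow_le_half hs p
  have hZ : HasProd (fun p => (1 - x p)⁻¹) (zetaSum s) := by
    have h : Tendsto (fun S : Finset Nat.Primes => Complex.re (∏ p ∈ S, (1 - (x p : ℂ))⁻¹))
      atTop (𝓝 (zetaSum s)) := (Complex.continuous_re.tendsto _).comp (hasProd_zetaSum hs)
    refine h.congr fun S => ?_
    rw [← Complex.ofReal_re (∏ p ∈ S, (1 - x p)⁻¹)]
    push_cast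
    rfl
  have hP : HasSum x (primeZetaSum s) := (summable_one_div_primes_rpow hs).hasSum
  have hQ : HasSum (fun p : Nat.Primes => x p + 2 * (1 / (p : ℝ) ^ (2 : ℝ)))
      (primeZetaSum s + 2 * primeZetaSum 2) :=
    hP.add ((summable_one_div_primes_rpow one_lt_two).hasSum.mul_left _)
  have lo : Real.exp (primeZetaSum s) ≤ zetaSum s := by
    refine le_of_tendsto_of_tendsto' hP.rexp hZ fun S => ?_
    refine Finset.prod_le_prod (fun p _ => (Real.exp_pos _).le) fun p _ => ?_
    have h1 : 0 < 1 - x p := by linarith [hx2 p]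
    rw [Function.comp, ← inv_inv (Real.exp (x p)), ← Real.exp_neg]
    refine inv_anti₀ h1 ?_
    linarith [Real.add_one_le_exp (-x p)]
  have hi : zetaSum s ≤ Real.exp (primeZetaSum s + 2 * primeZetaSum 2) := by
    refine le_of_tendsto_of_tendsto' hZ hQ.rexp fun S => ?_
    refine Finset.prod_le_prod (fun p _ => inv_nonneg.mpr (by linarith [hx2 p])) fun p _ => ?_
    have h1 : 0 < 1 - x p := by linarith [hx2 p]
    have h2 : (1 - x p)⁻¹ ≤ x p + 2 * x p ^ 2 + 1 := by
      rw [inv_le_iff_one_le_mul₀ h1]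
      nlinarith [mul_nonneg (sq_nonneg (x p)) (sub_nonneg.mpr (hx2 p))]
    refine (h2.trans ?_).trans (Real.add_one_le_exp _)
    have := one_div_prime_rpow_sq_le hs p
    linarith
  have l1 := (Real.le_log_iff_exp_le (zetaSum_pos hs)).mpr lo
  have l2 := (Real.log_le_iff_le_exp (zetaSum_pos hs)).mpr hi
  have : 0 ≤ primeZetaSum 2 := tsum_nonneg fun p => by positivity
  rw [abs_le]
  constructor <;> linarith

/-! ### The central limit theorem under the zeta distribution -/

/-- The zeta distribution on the positive integers, with weights proportional to `m ^ (-s)`. -/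
noncomputable def zetaLaw (s : ℝ) : Measure ℕ :=
  Measure.sum fun m : ℕ => ENNReal.ofReal (1 / (m : ℝ) ^ s / zetaSum s) • Measure.dirac m

theorem zetaSum_nonneg (s : ℝ) : 0 ≤ zetaSum s := tsum_nonneg fun m => by positivity

theorem integral_zetaLaw {E : Type*} [NormedAddCommGroup E] [NormedSpace ℝ E]
    [FiniteDimensional ℝ E] (s : ℝ) (f : ℕ → E) :
    ∫ m, f m ∂zetaLaw s = ∑' m : ℕ, (1 / (m : ℝ) ^ s / zetaSum s) • f m := by
  rw [zetaLaw, integral_sum_dirac (fun _ => ENNReal.ofReal_ne_top)]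
  refine tsum_congr fun m => ?_
  rw [ENNReal.toReal_ofReal (div_nonneg (by positivity) (zetaSum_nonneg s))]

theorem isProbabilityMeasure_zetaLaw {s : ℝ} (hs : 1 < s) : IsProbabilityMeasure (zetaLaw s) := by
  constructor
  have h0 : ∀ m : ℕ, 0 ≤ 1 / (m : ℝ) ^ s / zetaSum s := fun m =>
    div_nonneg (by positivity) (zetaSum_nonneg s)
  have h : zetaLaw s Set.univ = ∑' m : ℕ, ENNReal.ofReal (1 / (m : ℝ) ^ s / zetaSum s) := by
    simp [zetaLaw, Measure.sum_apply _ MeasurableSet.univ]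
  rw [h, ← ENNReal.ofReal_tsum_of_nonneg h0 ((Real.summable_one_div_nat_rpow.mpr hs).div_const _),
    tsum_div_const]
  change ENNReal.ofReal (zetaSum s / zetaSum s) = 1
  rw [div_self (zetaSum_pos hs).ne', ENNReal.ofReal_one]

/-- With θ = t/√L, the Taylor expansion is iθ(P - L) - θ²P/2 + O(θ³P). As θ²L = t² and θ → 0, a
bounded error P - L is harmless. -/
theorem tendsto_poisson_exponent (L P : ℕ → ℝ) (hL : Tendsto L atTop atTop) (C : ℝ)
    (hP : ∀ᶠ n in atTop, |P n - L n| ≤ C) (t : ℝ) :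
    Tendsto (fun n => (Complex.exp ((t / √(L n) : ℝ) * Complex.I) - 1) * P n -
        (t / √(L n) : ℝ) * Complex.I * L n) atTop (𝓝 (-(t : ℂ) ^ 2 / 2)) := by
  set θ : ℕ → ℝ := fun n => t / √(L n) with hθ
  have hθ0 : Tendsto θ atTop (𝓝 0) :=
    tendsto_const_nhds.div_atTop (Real.tendsto_sqrt_atTop.comp hL)
  have hθa : Tendsto (fun n => |θ n|) atTop (𝓝 0) := by simpa using hθ0.abs
  rw [tendsto_iff_norm_sub_tendsto_zero]
  have hlim : Tendsto (fun n => |θ n| * t ^ 2 + |θ n| ^ 3 * C + |θ n| * C + |θ n| ^ 2 / 2 * C)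
      atTop (𝓝 0) := by
    have := (((hθa.mul_const (t ^ 2)).add ((hθa.pow 3).mul_const C)).add (hθa.mul_const C)).add
      (((hθa.pow 2).div_const 2).mul_const C)
    simpa using this
  refine squeeze_zero' (Eventually.of_forall fun _ => norm_nonneg _) ?_ hlim
  filter_upwards [hP, hL.eventually_gt_atTop 0, hθa.eventually_le_const one_pos] with n h1 h2 h3
  have hsq : θ n ^ 2 * L n = t ^ 2 := by
    simp only [hθ]
    rw [div_pow, Real.sq_sqrt h2.le]
    field_simp
  have hsqC : ((θ n : ℂ)) ^ 2 * L n = (t : ℂ) ^ 2 := by exact_mod_cast hsq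
  have hn : ‖(θ n : ℂ) * Complex.I‖ = |θ n| := by simp
  have hT : ‖Complex.exp (θ n * Complex.I) - 1 - θ n * Complex.I + (θ n : ℂ) ^ 2 / 2‖ ≤
      |θ n| ^ 3 := by
    have h4 := Complex.exp_bound (x := (θ n : ℂ) * Complex.I) (n := 3) (by rw [hn]; exact h3)
      (by norm_num)
    rw [hn] at h4
    have e : Complex.exp (θ n * Complex.I) - 1 - θ n * Complex.I + (θ n : ℂ) ^ 2 / 2 =
        Complex.exp (θ n * Complex.I) - ∑ m ∈ Finset.range 3,
          ((θ n : ℂ) * Complex.I) ^ m / m.factorial := by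
      simp only [Finset.sum_range_succ, Finset.sum_range_zero, mul_pow, Complex.I_sq]
      norm_num [Nat.factorial]
      ring
    rw [e]
    refine h4.trans (mul_le_of_le_one_right (by positivity) ?_)
    norm_num [Nat.factorial]
  have hPn : |P n| ≤ L n + C := by
    rw [abs_le] at h1 ⊢
    constructor <;> linarith [h1.1, h1.2]
  have e : (Complex.exp (θ n * Complex.I) - 1) * P n - θ n * Complex.I * L n - -(t : ℂ) ^ 2 / 2 =
      (Complex.exp (θ n * Complex.I) - 1 - θ n * Complex.I + (θ n : ℂ) ^ 2 / 2) * P n +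
        θ n * Complex.I * ((P n - L n : ℝ) : ℂ) - (θ n : ℂ) ^ 2 / 2 * ((P n - L n : ℝ) : ℂ) := by
    rw [← hsqC]
    push_cast
    ring
  rw [e]
  have b1 : ‖(Complex.exp (θ n * Complex.I) - 1 - θ n * Complex.I + (θ n : ℂ) ^ 2 / 2) * P n‖ ≤
      |θ n| * t ^ 2 + |θ n| ^ 3 * C := by
    rw [norm_mul, Complex.norm_real, Real.norm_eq_abs]
    calc _ ≤ |θ n| ^ 3 * (L n + C) := mul_le_mul hT hPn (abs_nonneg _) (by positivity)
      _ = |θ n| * (|θ n| ^ 2 * L n) + |θ n| ^ 3 * C := by ring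
      _ = _ := by rw [sq_abs, hsq]
  have b2 : ‖(θ n : ℂ) * Complex.I * ((P n - L n : ℝ) : ℂ)‖ ≤ |θ n| * C := by
    rw [norm_mul, hn, Complex.norm_real, Real.norm_eq_abs]
    exact mul_le_mul_of_nonneg_left h1 (abs_nonneg _)
  have b3 : ‖(θ n : ℂ) ^ 2 / 2 * ((P n - L n : ℝ) : ℂ)‖ ≤ |θ n| ^ 2 / 2 * C := by
    rw [norm_mul, Complex.norm_real, Real.norm_eq_abs, norm_div, norm_pow, Complex.norm_real,
      Real.norm_eq_abs, Complex.norm_ofNat]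
    exact mul_le_mul_of_nonneg_left h1 (by positivity)
  exact (norm_sub_le _ _).trans (add_le_add ((norm_add_le _ _).trans (add_le_add b1 b2)) b3)

theorem charFun_map_zetaLaw (s L t : ℝ) :
    charFun ((zetaLaw s).map fun m =>
        ((ArithmeticFunction.cardDistinctFactors m : ℝ) - L) / √L) t =
      (∑' m : ℕ, ((1 / (m : ℝ) ^ s : ℝ) : ℂ) *
        Complex.exp ((t / √L : ℝ) * Complex.I) ^ ArithmeticFunction.cardDistinctFactors m) /
          zetaSum s * Complex.exp (-((t / √L : ℝ) * Complex.I * L)) := by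
  rw [charFun_apply_real, integral_map Measurable.of_discrete.aemeasurable (by fun_prop),
    integral_zetaLaw, ← tsum_div_const, ← tsum_mul_right]
  refine tsum_congr fun m => ?_
  rw [← Complex.exp_nat_mul, Complex.real_smul, Complex.ofReal_div, div_mul_eq_mul_div,
    div_mul_eq_mul_div, mul_assoc _ (Complex.exp _) (Complex.exp _), ← Complex.exp_add]
  congr 3
  push_cast
  ring

/-- Lévy's continuity theorem: at z = exp(it/√L) the Poisson error is O(t²/L), and the Poisson
exponent, once centred, tends to -t²/2. -/
theorem tendsto_zetaLaw_cardDistinctFactors (s L : ℕ → ℝ) (hs : ∀ n, 1 < s n)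
    (hL : Tendsto L atTop atTop) (C : ℝ)
    (hC : ∀ᶠ n in atTop, |Real.log (zetaSum (s n)) - L n| ≤ C) (x : ℝ) :
    Tendsto (fun n => (zetaLaw (s n)).real
        {m : ℕ | (ArithmeticFunction.cardDistinctFactors m : ℝ) - L n ≤ x * √(L n)})
      atTop (𝓝 ((gaussianReal 0 1).real (Set.Iic x))) := by
  have hprob : ∀ n, IsProbabilityMeasure (zetaLaw (s n)) := fun n =>
    isProbabilityMeasure_zetaLaw (hs n)
  let φ : ℕ → ℕ → ℝ := fun n m =>
    ((ArithmeticFunction.cardDistinctFactors m : ℝ) - L n) / √(L n)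
  have hφ : ∀ n, Measurable (φ n) := fun n => Measurable.of_discrete
  let μ : ℕ → ProbabilityMeasure ℝ := fun n =>
    ⟨(zetaLaw (s n)).map (φ n), Measure.isProbabilityMeasure_map (hφ n).aemeasurable⟩
  let γ : ProbabilityMeasure ℝ := ⟨gaussianReal 0 1, inferInstance⟩
  have hP : ∀ᶠ n in atTop, |primeZetaSum (s n) - L n| ≤ 2 * primeZetaSum 2 + C := by
    filter_upwards [hC] with n hn
    refine (abs_sub_le _ (Real.log (zetaSum (s n))) _).trans ?_
    exact add_le_add (abs_primeZetaSum_sub_log_zetaSum_le (hs n)) hn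
  have hμ : Tendsto μ atTop (𝓝 γ) := by
    refine ProbabilityMeasure.tendsto_iff_tendsto_charFun.mpr fun t => ?_
    change Tendsto (fun n => charFun ((zetaLaw (s n)).map (φ n)) t) atTop
      (𝓝 (charFun (gaussianReal 0 1) t))
    have hE := (tendsto_poisson_exponent L _ hL _ hP t).cexp
    have hg : charFun (gaussianReal 0 1) t = Complex.exp (-(t : ℂ) ^ 2 / 2) := by
      rw [charFun_gaussianReal]
      simp [neg_div]
    rw [hg]
    refine tendsto_of_tendsto_of_dist hE ?_
    have hθ : Tendsto (fun n => ‖t / √(L n)‖ ^ 2 * primeZetaSum 2) atTop (𝓝 0) := by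
      have h : Tendsto (fun n => t / √(L n)) atTop (𝓝 0) :=
        tendsto_const_nhds.div_atTop (Real.tendsto_sqrt_atTop.comp hL)
      simpa using (h.norm.pow 2).mul_const (primeZetaSum 2)
    refine squeeze_zero (fun _ => dist_nonneg) (fun n => ?_) hθ
    rw [dist_comm, dist_eq_norm]
    change ‖charFun ((zetaLaw (s n)).map fun m => _) t - _‖ ≤ _
    -- The centring factor has modulus one and drops out of the norm.
    rw [charFun_map_zetaLaw, sub_eq_add_neg _ (((t / √(L n) : ℝ) : ℂ) * _ * _), Complex.exp_add,
      ← sub_mul, norm_mul, ← neg_mul, ← neg_mul, ← Complex.ofReal_neg, mul_right_comm,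
      ← Complex.ofReal_mul, Complex.norm_exp_ofReal_mul_I, mul_one]
    refine (norm_euler_sub_exp_le (hs n) (Complex.norm_exp_ofReal_mul_I _)).trans ?_
    have hnn : 0 ≤ primeZetaSum 2 := tsum_nonneg fun p => by positivity
    refine mul_le_mul_of_nonneg_right (pow_le_pow_left₀ (norm_nonneg _) ?_ 2) hnn
    rw [mul_comm]
    exact Real.norm_exp_I_mul_ofReal_sub_one_le
  have hport := ProbabilityMeasure.tendsto_measure_of_null_frontier_of_tendsto' hμ
    (E := Set.Iic x) (by
      rw [frontier_Iic]
      have : NullSingletonClass (gaussianReal 0 1) :=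
        nullSingletonClass_gaussianReal one_ne_zero
      exact measure_singleton (μ := gaussianReal 0 1) x)
  have hreal := (ENNReal.tendsto_toReal (measure_ne_top (γ : Measure ℝ) (Set.Iic x))).comp hport
  refine Tendsto.congr' ?_ hreal
  filter_upwards [hL.eventually_gt_atTop 0] with n hn
  change ((zetaLaw (s n)).map (φ n) (Set.Iic x)).toReal = _
  rw [Measure.map_apply (hφ n) measurableSet_Iic, Measure.real]
  congr 2
  ext m
  simp only [Set.mem_preimage, Set.mem_Iic, Set.mem_ofPred_eq, φ]
  exact div_le_iff₀ (Real.sqrt_pos.mpr hn)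

/-! ### Karamata's theorem by moments on [0, 1] -/

theorem tendsto_integral_polynomial_of_moments {Ω : Type*} [MeasurableSpace Ω]
    (μ : ℕ → Measure Ω) [∀ n, IsFiniteMeasure (μ n)] (Y : ℕ → Ω → ℝ)
    (hY : ∀ n, Measurable (Y n)) (hY01 : ∀ n ω, Y n ω ∈ Set.Icc (0 : ℝ) 1) (c : ℝ)
    (h : ∀ j : ℕ, Tendsto (fun n => ∫ ω, Y n ω ^ j ∂μ n) atTop (𝓝 (c / (j + 1))))
    (p : Polynomial ℝ) :
    Tendsto (fun n => ∫ ω, p.eval (Y n ω) ∂μ n) atTop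
      (𝓝 (c * ∫ y in (0 : ℝ)..1, p.eval y)) := by
  have hint : ∀ (q : Polynomial ℝ) (n : ℕ), Integrable (fun ω => q.eval (Y n ω)) (μ n) := by
    intro q n
    obtain ⟨C, hC⟩ := isCompact_Icc.exists_bound_of_continuousOn (s := Set.Icc (0 : ℝ) 1)
      q.continuous.continuousOn
    exact Integrable.of_bound (q.continuous.measurable.comp (hY n)).aestronglyMeasurable C
      (Eventually.of_forall fun ω => hC _ (hY01 n ω))
  induction p using Polynomial.induction_on' with
  | add p q hp hq =>
    have e : ∀ n, ∫ ω, (p + q).eval (Y n ω) ∂μ n =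
        ∫ ω, p.eval (Y n ω) ∂μ n + ∫ ω, q.eval (Y n ω) ∂μ n := fun n => by
      simp only [Polynomial.eval_add]
      exact integral_add (hint p n) (hint q n)
    have e' : ∫ y in (0 : ℝ)..1, (p + q).eval y =
        (∫ y in (0 : ℝ)..1, p.eval y) + ∫ y in (0 : ℝ)..1, q.eval y := by
      simp only [Polynomial.eval_add]
      exact intervalIntegral.integral_add (p.continuous.intervalIntegrable _ _)
        (q.continuous.intervalIntegrable _ _)
    simp only [e, e', mul_add]
    exact hp.add hq
  | monomial j b =>
    simp only [Polynomial.eval_monomial, integral_const_mul, intervalIntegral.integral_const_mul,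
      integral_pow]
    have := (h j).const_mul b
    convert! this using 2
    simp
    ring

/-- Serves discontinuous g: Weierstrass approximation turns continuous majorants and minorants into
polynomial ones, whose integrals are controlled by the moments. -/
theorem tendsto_integral_of_moments_of_sandwich {Ω : Type*} [MeasurableSpace Ω]
    (μ : ℕ → Measure Ω) [∀ n, IsFiniteMeasure (μ n)] (Y : ℕ → Ω → ℝ)
    (hY : ∀ n, Measurable (Y n)) (hY01 : ∀ n ω, Y n ω ∈ Set.Icc (0 : ℝ) 1) {c : ℝ} (hc : 0 ≤ c)
    (h : ∀ j : ℕ, Tendsto (fun n => ∫ ω, Y n ω ^ j ∂μ n) atTop (𝓝 (c / (j + 1))))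
    (g : ℝ → ℝ) (hg : Measurable g) (I : ℝ)
    (hup : ∀ ε > 0, ∃ f : ℝ → ℝ, Continuous f ∧ (∀ y ∈ Set.Icc (0 : ℝ) 1, g y ≤ f y) ∧
      ∫ y in (0 : ℝ)..1, f y ≤ I + ε)
    (hlo : ∀ ε > 0, ∃ f : ℝ → ℝ, Continuous f ∧ (∀ y ∈ Set.Icc (0 : ℝ) 1, f y ≤ g y) ∧
      I - ε ≤ ∫ y in (0 : ℝ)..1, f y) :
    Tendsto (fun n => ∫ ω, g (Y n ω) ∂μ n) atTop (𝓝 (c * I)) := by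
  have hup' : ∀ ε > 0, ∃ p : Polynomial ℝ, (∀ y ∈ Set.Icc (0 : ℝ) 1, g y ≤ p.eval y) ∧
      ∫ y in (0 : ℝ)..1, p.eval y ≤ I + ε := by
    intro ε hε
    obtain ⟨f, hf, hgf, hI⟩ := hup (ε / 3) (by positivity)
    obtain ⟨p, hp⟩ := exists_polynomial_near_of_continuousOn 0 1 f hf.continuousOn (ε / 3)
      (by positivity)
    -- The shift by ε/3 restores the majorant; approximation, shift and the excess of f use ε/3
    -- each.
    refine ⟨p + Polynomial.C (ε / 3), fun y hy => ?_, ?_⟩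
    · have := (abs_lt.mp (hp y hy)).1
      simp only [Polynomial.eval_add, Polynomial.eval_C]
      linarith [hgf y hy]
    · have : ∫ y in (0 : ℝ)..1, (p + Polynomial.C (ε / 3)).eval y ≤
          ∫ y in (0 : ℝ)..1, (f y + 2 * (ε / 3)) := by
        refine intervalIntegral.integral_mono_on zero_le_one
          ((Polynomial.continuous _).intervalIntegrable _ _)
          ((hf.add continuous_const).intervalIntegrable _ _) fun y hy => ?_
        have := (abs_lt.mp (hp y hy)).2
        simp only [Polynomial.eval_add, Polynomial.eval_C]
        linarith
      rw [intervalIntegral.integral_add (hf.intervalIntegrable _ _)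
        (continuous_const.intervalIntegrable _ _), intervalIntegral.integral_const] at this
      norm_num at this ⊢
      linarith
  have hlo' : ∀ ε > 0, ∃ p : Polynomial ℝ, (∀ y ∈ Set.Icc (0 : ℝ) 1, p.eval y ≤ g y) ∧
      I - ε ≤ ∫ y in (0 : ℝ)..1, p.eval y := by
    intro ε hε
    obtain ⟨f, hf, hgf, hI⟩ := hlo (ε / 3) (by positivity)
    obtain ⟨p, hp⟩ := exists_polynomial_near_of_continuousOn 0 1 f hf.continuousOn (ε / 3)
      (by positivity)
    refine ⟨p - Polynomial.C (ε / 3), fun y hy => ?_, ?_⟩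
    · have := (abs_lt.mp (hp y hy)).2
      simp only [Polynomial.eval_sub, Polynomial.eval_C]
      linarith [hgf y hy]
    · have : ∫ y in (0 : ℝ)..1, (f y - 2 * (ε / 3)) ≤
          ∫ y in (0 : ℝ)..1, (p - Polynomial.C (ε / 3)).eval y := by
        refine intervalIntegral.integral_mono_on zero_le_one
          ((hf.sub continuous_const).intervalIntegrable _ _)
          ((Polynomial.continuous _).intervalIntegrable _ _) fun y hy => ?_
        have := (abs_lt.mp (hp y hy)).1
        simp only [Polynomial.eval_sub, Polynomial.eval_C]
        linarith
      rw [intervalIntegral.integral_sub (hf.intervalIntegrable _ _)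
        (continuous_const.intervalIntegrable _ _), intervalIntegral.integral_const] at this
      norm_num at this ⊢
      linarith
  have hint : ∀ (q : Polynomial ℝ), ∃ C, ∀ y ∈ Set.Icc (0 : ℝ) 1, ‖q.eval y‖ ≤ C := fun q =>
    isCompact_Icc.exists_bound_of_continuousOn q.continuous.continuousOn
  have hqi : ∀ (q : Polynomial ℝ) (n : ℕ), Integrable (fun ω => q.eval (Y n ω)) (μ n) := by
    intro q n
    obtain ⟨C, hC⟩ := hint q
    exact Integrable.of_bound (q.continuous.measurable.comp (hY n)).aestronglyMeasurable C
      (Eventually.of_forall fun ω => hC _ (hY01 n ω))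
  have hgi : ∀ n, Integrable (fun ω => g (Y n ω)) (μ n) := by
    intro n
    obtain ⟨p, hp, -⟩ := hup' 1 one_pos
    obtain ⟨q, hq, -⟩ := hlo' 1 one_pos
    exact integrable_of_le_of_le (hg.comp (hY n)).aestronglyMeasurable
      (Eventually.of_forall fun ω => hq _ (hY01 n ω))
      (Eventually.of_forall fun ω => hp _ (hY01 n ω)) (hqi q n) (hqi p n)
  refine Metric.tendsto_nhds.mpr fun ε hε => ?_
  -- c + 1 rather than c, since c may vanish.
  have hε' : 0 < ε / (2 * (c + 1)) := by positivity
  have hcε : c * (ε / (2 * (c + 1))) ≤ ε / 2 := by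
    rw [mul_div_assoc', div_le_div_iff₀ (by positivity) two_pos]
    nlinarith
  obtain ⟨p, hp, hpI⟩ := hup' _ hε'
  obtain ⟨q, hq, hqI⟩ := hlo' _ hε'
  have tp := tendsto_integral_polynomial_of_moments μ Y hY hY01 c h p
  have tq := tendsto_integral_polynomial_of_moments μ Y hY hY01 c h q
  have hpI' := mul_le_mul_of_nonneg_left hpI hc
  have hqI' := mul_le_mul_of_nonneg_left hqI hc
  filter_upwards [tp.eventually_lt_const (lt_add_of_pos_right _ (half_pos hε)),
    tq.eventually_const_lt (sub_lt_self _ (half_pos hε))] with n h1 h2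
  have h3 : ∫ ω, g (Y n ω) ∂μ n ≤ ∫ ω, p.eval (Y n ω) ∂μ n :=
    integral_mono (hgi n) (hqi p n) fun ω => hp _ (hY01 n ω)
  have h4 : ∫ ω, q.eval (Y n ω) ∂μ n ≤ ∫ ω, g (Y n ω) ∂μ n :=
    integral_mono (hqi q n) (hgi n) fun ω => hq _ (hY01 n ω)
  rw [Real.dist_eq, abs_lt]
  constructor <;> linarith

/-- The continuous function equal to `0` before `u`, to `1` after `v`, and affine between. -/
noncomputable def ramp (u v y : ℝ) : ℝ := max 0 (min 1 ((y - u) / (v - u)))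

theorem continuous_ramp (u v : ℝ) : Continuous (ramp u v) := by
  unfold ramp
  fun_prop

theorem ramp_nonneg (u v y : ℝ) : 0 ≤ ramp u v y := le_max_left _ _

theorem ramp_le_one (u v y : ℝ) : ramp u v y ≤ 1 := max_le zero_le_one (min_le_left _ _)

theorem ramp_of_le {u v y : ℝ} (h : u < v) (hy : y ≤ u) : ramp u v y = 0 :=
  max_eq_left ((min_le_right _ _).trans (div_nonpos_of_nonpos_of_nonneg (by linarith)
    (by linarith)))

theorem ramp_of_ge {u v y : ℝ} (h : u < v) (hy : v ≤ y) : ramp u v y = 1 := by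
  have : 1 ≤ (y - u) / (v - u) := (one_le_div (by linarith)).mpr (by linarith)
  rw [ramp, min_eq_left this, max_eq_right zero_le_one]

/-- Split at u and v: the pieces are 0, at most (v - u)/a, and ∫ dy/y over [v, 1]. Writing `max y a`
keeps the integrand continuous at 0 and changes nothing on [v, 1]. -/
theorem integral_ramp_mul_inv_bounds {a u v : ℝ} (ha : 0 < a) (hu : 0 ≤ u) (huv : u < v)
    (hav : a ≤ v) (hv : v ≤ 1) :
    -Real.log v ≤ ∫ y in (0 : ℝ)..1, ramp u v y * (max y a)⁻¹ ∧
      ∫ y in (0 : ℝ)..1, ramp u v y * (max y a)⁻¹ ≤ -Real.log v + (v - u) * a⁻¹ := by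
  set F : ℝ → ℝ := fun y => ramp u v y * (max y a)⁻¹ with hF
  have hFc : Continuous F := (continuous_ramp u v).mul
    (Continuous.inv₀ (by fun_prop) fun y => (ha.trans_le (le_max_right y a)).ne')
  have hi : ∀ x y, IntervalIntegrable F volume x y := fun x y => hFc.intervalIntegrable x y
  have hv0 : 0 < v := ha.trans_le hav
  have h1 : ∫ y in (0 : ℝ)..u, F y = 0 := by
    refine (intervalIntegral.integral_congr fun y hy => ?_).trans intervalIntegral.integral_zero
    rw [Set.uIcc_of_le hu] at hy
    simp [hF, ramp_of_le huv hy.2]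
  have h3 : ∫ y in v..1, F y = -Real.log v := by
    have : ∫ y in v..1, F y = ∫ y in v..1, y⁻¹ := by
      refine intervalIntegral.integral_congr fun y hy => ?_
      rw [Set.uIcc_of_le hv] at hy
      simp [hF, ramp_of_ge huv hy.1, max_eq_left (hav.trans hy.1)]
    rw [this, integral_inv_of_pos hv0 one_pos, one_div, Real.log_inv]
  have h2 : 0 ≤ ∫ y in u..v, F y := by
    refine intervalIntegral.integral_nonneg huv.le fun y _ => ?_
    exact mul_nonneg (ramp_nonneg _ _ _) (inv_nonneg.mpr (ha.le.trans (le_max_right _ _)))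
  have h2' : ∫ y in u..v, F y ≤ (v - u) * a⁻¹ := by
    have : ∫ y in u..v, F y ≤ ∫ y in u..v, a⁻¹ := by
      refine intervalIntegral.integral_mono_on huv.le (hi _ _)
        (continuous_const.intervalIntegrable _ _) fun y _ => ?_
      have hq : (max y a)⁻¹ ≤ a⁻¹ := inv_anti₀ ha (le_max_right _ _)
      exact (mul_le_of_le_one_left (inv_nonneg.mpr (ha.le.trans (le_max_right _ _)))
        (ramp_le_one _ _ _)).trans hq
    simpa using this
  have hsplit : ∫ y in (0 : ℝ)..1, F y =
      (∫ y in (0 : ℝ)..u, F y) + (∫ y in u..v, F y) + ∫ y in v..1, F y := by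
    rw [intervalIntegral.integral_add_adjacent_intervals (hi _ _) (hi _ _),
      intervalIntegral.integral_add_adjacent_intervals (hi _ _) (hi _ _)]
  rw [hsplit, h1, h3]
  constructor <;> linarith

/-- A form of Karamata's theorem: convergence of the moments to those of `c` times Lebesgue measure
on `[0, 1]` gives convergence of the integrals of the truncated reciprocal. -/
theorem tendsto_integral_truncated_inv {Ω : Type*} [MeasurableSpace Ω]
    (μ : ℕ → Measure Ω) [∀ n, IsFiniteMeasure (μ n)] (Y : ℕ → Ω → ℝ)
    (hY : ∀ n, Measurable (Y n)) (hY01 : ∀ n ω, Y n ω ∈ Set.Icc (0 : ℝ) 1) {c : ℝ} (hc : 0 ≤ c)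
    (h : ∀ j : ℕ, Tendsto (fun n => ∫ ω, Y n ω ^ j ∂μ n) atTop (𝓝 (c / (j + 1)))) :
    Tendsto (fun n => ∫ ω, (Set.Ici (Real.exp (-1))).indicator (fun y => y⁻¹) (Y n ω) ∂μ n)
      atTop (𝓝 c) := by
  set a := Real.exp (-1) with ha
  have ha0 : 0 < a := Real.exp_pos _
  have ha1 : a < 1 := by
    rw [ha, Real.exp_lt_one_iff]
    norm_num
  have hla : Real.log a = -1 := Real.log_exp _
  have hcont : ∀ u v, Continuous fun y => ramp u v y * (max y a)⁻¹ := fun u v =>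
    (continuous_ramp u v).mul
      (Continuous.inv₀ (by fun_prop) fun y => (ha0.trans_le (le_max_right y a)).ne')
  have hq0 : ∀ y, 0 ≤ (max y a)⁻¹ := fun y => inv_nonneg.mpr (ha0.le.trans (le_max_right _ _))
  -- The limit integral is 1 because ∫ dy/y over [1/e, 1] equals 1.
  have key := tendsto_integral_of_moments_of_sandwich μ Y hY hY01 hc h
    ((Set.Ici a).indicator fun y => y⁻¹) (measurable_inv.indicator measurableSet_Ici) 1 ?_ ?_
  · simpa using key
  · intro ε hε
    -- The first bound makes the excess η/a at most ε, the second keeps the ramp inside [0, 1].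
    set η := min (ε * a) a with hη
    have hη0 : 0 < η := by positivity
    refine ⟨_, hcont (a - η) a, fun y hy => ?_, ?_⟩
    · by_cases hya : a ≤ y
      · rw [Set.indicator_of_mem (Set.mem_Ici.mpr hya), ramp_of_ge (by linarith) hya,
          max_eq_left hya, one_mul]
      · rw [Set.indicator_of_notMem (by simpa using hya)]
        exact mul_nonneg (ramp_nonneg _ _ _) (hq0 y)
    · refine (integral_ramp_mul_inv_bounds ha0 (by linarith [min_le_right (ε * a) a])
        (by linarith) le_rfl ha1.le).2.trans ?_
      rw [hla, neg_neg, sub_sub_cancel, ← div_eq_mul_inv]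
      have : η / a ≤ ε := (div_le_iff₀ ha0).mpr (min_le_left _ _)
      linarith
  · intro ε hε
    set η := min (ε * a) (1 - a) with hη
    have hη0 : 0 < η := lt_min (by positivity) (by linarith)
    refine ⟨_, hcont a (a + η), fun y hy => ?_, ?_⟩
    · by_cases hya : a ≤ y
      · rw [Set.indicator_of_mem (Set.mem_Ici.mpr hya), max_eq_left hya]
        exact mul_le_of_le_one_left (inv_nonneg.mpr hy.1) (ramp_le_one _ _ _)
      · rw [Set.indicator_of_notMem (by simpa using hya),
          ramp_of_le (by linarith) (not_le.mp hya).le, zero_mul]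
    · refine le_trans ?_ (integral_ramp_mul_inv_bounds ha0 ha0.le (by linarith)
        (by linarith) (by linarith [min_le_right (ε * a) (1 - a)])).1
      have e : a + η = a * (1 + η / a) := by field_simp
      have h0 : 0 < η / a := by positivity
      rw [e, Real.log_mul ha0.ne' (by positivity), hla]
      have h1 := Real.log_le_sub_one_of_pos (show 0 < 1 + η / a by positivity)
      have : η / a ≤ ε := (div_le_iff₀ ha0).mpr (min_le_left _ _)
      linarith

/-! ### From zeta distributions to logarithmic density -/

theorem tendsto_mul_zetaSum (σ : ℕ → ℝ) (hσ : ∀ n, 0 < σ n) (hσ0 : Tendsto σ atTop (𝓝 0)) :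
    Tendsto (fun n => σ n * zetaSum (1 + σ n)) atTop (𝓝 1) := by
  have h1 : Tendsto (fun n => 1 + σ n) atTop (𝓝[>] 1) := by
    refine tendsto_nhdsWithin_iff.mpr ⟨by simpa using hσ0.const_add 1, ?_⟩
    exact Eventually.of_forall fun n => by simpa using hσ n
  refine (tendsto_sub_mul_tsum_nat_rpow.comp h1).congr fun n => ?_
  simp [zetaSum]

/-- The restriction of the zeta distribution to `A`, with total mass normalised to
`σ * ∑_{m ∈ A} m ^ (-(1 + σ))`. -/
noncomputable def scaledZetaLaw (σ : ℝ) (A : Set ℕ) : Measure ℕ :=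
  ENNReal.ofReal (σ * zetaSum (1 + σ)) • (zetaLaw (1 + σ)).restrict A

theorem integral_scaledZetaLaw {σ : ℝ} (hσ : 0 < σ) (A : Set ℕ) (f : ℕ → ℝ) :
    ∫ m, f m ∂scaledZetaLaw σ A =
      σ * ∑' m : ℕ, 1 / (m : ℝ) ^ (1 + σ) * A.indicator f m := by
  have hZ : 0 < zetaSum (1 + σ) := zetaSum_pos (by linarith)
  rw [scaledZetaLaw, integral_smul_measure, ← integral_indicator MeasurableSet.of_discrete,
    integral_zetaLaw, ENNReal.toReal_ofReal (by positivity), smul_eq_mul, mul_assoc,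
    ← tsum_mul_left]
  congr 1
  refine tsum_congr fun m => ?_
  rw [smul_eq_mul]
  field_simp

/-- Multiplying m^(-(1+σ)) by m^(-jσ) only moves the exponent to 1 + (j+1)σ, so each moment is a
mass under another zeta law. -/
theorem scaledZetaLaw_integral_pow {σ : ℝ} (hσ : 0 < σ) (A : Set ℕ) (j : ℕ) :
    ∫ m : ℕ, (1 / (m : ℝ) ^ σ) ^ j ∂scaledZetaLaw σ A =
      σ * (zetaSum (1 + (j + 1) * σ) * (zetaLaw (1 + (j + 1) * σ)).real A) := by
  have hj : 0 < (j + 1) * σ := by positivity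
  have hZ : 0 < zetaSum (1 + (j + 1) * σ) := zetaSum_pos (by linarith)
  rw [integral_scaledZetaLaw hσ, ← integral_indicator_one (s := A) MeasurableSet.of_discrete,
    integral_zetaLaw]
  congr 1
  rw [← tsum_mul_left]
  refine tsum_congr fun m => ?_
  rw [smul_eq_mul, ← mul_assoc, mul_div_cancel₀ _ hZ.ne']
  by_cases hm : m ∈ A
  · rw [Set.indicator_of_mem hm, Set.indicator_of_mem hm, Pi.one_apply, mul_one]
    rcases Nat.eq_zero_or_pos m with rfl | hm0
    · rw [Nat.cast_zero, Real.zero_rpow (show 1 + σ ≠ 0 by linarith),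
        Real.zero_rpow (show 1 + ((j : ℝ) + 1) * σ ≠ 0 by linarith)]
      simp
    · have hm' : (0 : ℝ) < m := by exact_mod_cast hm0
      rw [div_pow, one_pow, one_div_mul_one_div, ← Real.rpow_natCast, ← Real.rpow_mul hm'.le,
        ← Real.rpow_add hm']
      congr 2
      ring
  · simp [Set.indicator_of_notMem hm]

/-- For m ≥ 1 and σ = 1/log n, m^(-σ) ≥ 1/e exactly when m ≤ n, and the reciprocal turns m^(-(1+σ))
into 1/m. -/
theorem scaledZetaLaw_integral_truncated_inv {n : ℕ} (hn : 2 ≤ n) (A : Set ℕ) :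
    ∫ m : ℕ, (Set.Ici (Real.exp (-1))).indicator (fun y => y⁻¹)
        (1 / (m : ℝ) ^ (1 / Real.log n)) ∂scaledZetaLaw (1 / Real.log n) A =
      1 / Real.log n * ∑ m ∈ Finset.Icc 1 n, A.indicator (fun m : ℕ => 1 / (m : ℝ)) m := by
  have hn1 : (1 : ℝ) < n := by exact_mod_cast hn
  have hlog : 0 < Real.log n := Real.log_pos hn1
  have hσ : 0 < 1 / Real.log n := by positivity
  rw [integral_scaledZetaLaw hσ]
  set σ := 1 / Real.log n with hσdef
  congr 1
  rw [tsum_eq_sum (s := Finset.Icc 1 n)]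
  · refine Finset.sum_congr rfl fun m hm => ?_
    obtain ⟨hm1, hmn⟩ := Finset.mem_Icc.mp hm
    have hm' : (0 : ℝ) < m := by exact_mod_cast hm1
    by_cases hmA : m ∈ A
    · rw [Set.indicator_of_mem hmA, Set.indicator_of_mem hmA, Set.indicator_of_mem]
      · rw [Real.rpow_add hm', Real.rpow_one]
        field_simp
      · rw [Set.mem_Ici, one_div, Real.exp_neg]
        refine inv_anti₀ (by positivity) ?_
        rw [Real.rpow_def_of_pos hm', Real.exp_le_exp, hσdef, mul_one_div, div_le_one hlog]
        exact Real.log_le_log hm' (by exact_mod_cast hmn)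
    · simp [Set.indicator_of_notMem hmA]
  · intro m hm
    by_cases hmA : m ∈ A
    · rw [Set.indicator_of_mem hmA]
      rcases Nat.eq_zero_or_pos m with rfl | hm0
      · rw [Nat.cast_zero, Real.zero_rpow (by linarith)]
        simp
      · have hnm : n < m := by
          by_contra hc
          exact hm (Finset.mem_Icc.mpr ⟨hm0, not_lt.mp hc⟩)
        have hm' : (0 : ℝ) < m := by exact_mod_cast hm0
        rw [Set.indicator_of_notMem, mul_zero]
        rw [Set.mem_Ici, not_le, one_div, Real.exp_neg]
        refine inv_strictAnti₀ (Real.exp_pos _) ?_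
        rw [Real.rpow_def_of_pos hm', Real.exp_lt_exp, hσdef, mul_one_div, one_lt_div hlog]
        exact Real.log_lt_log (by linarith) (by exact_mod_cast hnm)
    · simp [Set.indicator_of_notMem hmA]

/-- If the zeta distributions with parameters `1 + k / log n` all give `A n` a mass tending to `c`,
then so does the logarithmic density on `{1, …, n}`. -/
theorem tendsto_logarithmic_density_of_zetaLaw (σ : ℕ → ℝ) (hσ : ∀ n, 0 < σ n)
    (hσn : ∀ᶠ n : ℕ in atTop, σ n = 1 / Real.log n) (A : ℕ → Set ℕ) {c : ℝ}
    (h : ∀ j : ℕ, Tendsto (fun n => (zetaLaw (1 + (j + 1) * σ n)).real (A n)) atTop (𝓝 c)) :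
    Tendsto (fun n : ℕ => 1 / Real.log n *
      ∑ m ∈ Finset.Icc 1 n, (A n).indicator (fun m : ℕ => 1 / (m : ℝ)) m) atTop (𝓝 c) := by
  have hσ0 : Tendsto σ atTop (𝓝 0) := by
    refine Tendsto.congr' (hσn.mono fun n hn => hn.symm) ?_
    exact tendsto_const_nhds.div_atTop
      (Real.tendsto_log_atTop.comp tendsto_natCast_atTop_atTop)
  have hc : 0 ≤ c := ge_of_tendsto' (h 0) fun n => measureReal_nonneg
  have hfin : ∀ n, IsFiniteMeasure (scaledZetaLaw (σ n) (A n)) := by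
    intro n
    have := isProbabilityMeasure_zetaLaw (show 1 < 1 + σ n by linarith [hσ n])
    unfold scaledZetaLaw
    exact Measure.smul_finite _ ENNReal.ofReal_ne_top
  have key := tendsto_integral_truncated_inv (fun n => scaledZetaLaw (σ n) (A n))
    (fun n m => 1 / (m : ℝ) ^ σ n) (fun n => Measurable.of_discrete) (fun n m => ?_) hc
    (fun j => ?_)
  · refine key.congr' ?_
    filter_upwards [hσn, eventually_ge_atTop 2] with n h1 h2
    rw [h1]
    exact scaledZetaLaw_integral_truncated_inv h2 (A n)
  · refine ⟨by positivity, ?_⟩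
    rcases Nat.eq_zero_or_pos m with rfl | hm0
    · rw [Nat.cast_zero, Real.zero_rpow (hσ n).ne']
      simp
    · exact div_le_one_of_le₀ (Real.one_le_rpow (by exact_mod_cast hm0) (hσ n).le)
        (by positivity)
  · have hj : (0 : ℝ) < j + 1 := by positivity
    -- The pole of ζ at 1 has residue 1, so σ ζ(1 + (j+1)σ) tends to 1/(j+1), the moment of Lebesgue
    -- measure.
    have h1 := tendsto_mul_zetaSum (fun n => (j + 1) * σ n) (fun n => mul_pos hj (hσ n))
      (by simpa using hσ0.const_mul ((j : ℝ) + 1))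
    have h2 := (h1.mul (h j)).div_const ((j : ℝ) + 1)
    rw [one_mul] at h2
    refine h2.congr fun n => ?_
    rw [scaledZetaLaw_integral_pow (hσ n)]
    field_simp

/-! ### Zipf and harmonic distributions -/

theorem zipfMeasure_real_apply (s : ℝ) (n : ℕ) (A : Set ℕ) :
    (zipfMeasure s n).real A = ∑ j ∈ Finset.Icc 1 n, A.indicator (zipfMass s n) j := by
  classical
  rw [Measure.real, zipfMeasure, measureOnInitial, Measure.finsetSum_apply,
    ENNReal.toReal_sum fun j _ => by
      rw [Measure.smul_apply, smul_eq_mul]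
      exact ENNReal.mul_ne_top ENNReal.ofReal_ne_top (measure_ne_top _ _)]
  refine Finset.sum_congr rfl fun j _ => ?_
  rw [Measure.smul_apply, smul_eq_mul, Measure.dirac_apply, ENNReal.toReal_mul,
    ENNReal.toReal_ofReal (zipfMass_nonneg s n j)]
  by_cases hj : j ∈ A <;> simp [hj]

theorem integral_zipfMeasure (s : ℝ) (n : ℕ) (f : ℕ → ℝ) :
    ∫ m, f m ∂zipfMeasure s n = ∑ j ∈ Finset.Icc 1 n, zipfMass s n j * f j := by
  rw [zipfMeasure, measureOnInitial, integral_finsetSum_measure fun j _ =>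
    (integrable_dirac (by simp)).smul_measure ENNReal.ofReal_ne_top]
  refine Finset.sum_congr rfl fun j _ => ?_
  rw [integral_smul_measure, integral_dirac, ENNReal.toReal_ofReal (zipfMass_nonneg s n j),
    smul_eq_mul]

theorem continuous_zipfMass {n j : ℕ} (hj : j ∈ Finset.Icc 1 n) :
    Continuous fun s => zipfMass s n j := by
  have hpos : ∀ i ∈ Finset.Icc 1 n, (0 : ℝ) < i := fun i hi => by
    exact_mod_cast (Finset.mem_Icc.mp hi).1
  have hc : ∀ i ∈ Finset.Icc 1 n, Continuous fun s : ℝ => (i : ℝ) ^ s := fun i hi =>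
    continuous_const.rpow continuous_id fun _ => Or.inl (hpos i hi).ne'
  have hp : ∀ i ∈ Finset.Icc 1 n, ∀ s : ℝ, 0 < (i : ℝ) ^ s := fun i hi s =>
    Real.rpow_pos_of_pos (hpos i hi) s
  unfold zipfMass
  refine continuous_const.div ((hc j hj).mul (continuous_finsetSum _ fun i hi =>
    continuous_const.div (hc i hi) fun s => (hp i hi s).ne')) fun s => ?_
  exact (mul_pos (hp j hj s) (Finset.sum_pos (fun i hi => one_div_pos.mpr (hp i hi s))
    ⟨j, hj⟩)).ne'

/-- Uniform in A, so that δ_n can be chosen before x. -/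
theorem abs_zipfMeasure_real_sub_le (s t : ℝ) (n : ℕ) (A : Set ℕ) :
    |(zipfMeasure s n).real A - (zipfMeasure t n).real A| ≤
      ∑ j ∈ Finset.Icc 1 n, |zipfMass s n j - zipfMass t n j| := by
  rw [zipfMeasure_real_apply, zipfMeasure_real_apply, ← Finset.sum_sub_distrib]
  refine (Finset.abs_sum_le_sum_abs _ _).trans (Finset.sum_le_sum fun j _ => ?_)
  by_cases hj : j ∈ A <;> simp [hj]

/-- The **Erdős–Kac theorem** for the harmonic distributions. -/
theorem tendsto_harmonic_cardDistinctFactors (x : ℝ) :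
    Tendsto (fun n : ℕ => (zipfMeasure 1 n).real
        {m : ℕ | (ArithmeticFunction.cardDistinctFactors m : ℝ) - Real.log (Real.log n)
          ≤ x * √(Real.log (Real.log n))})
      atTop (𝓝 ((gaussianReal 0 1).real (Set.Iic x))) := by
  set A : ℕ → Set ℕ := fun n =>
    {m : ℕ | (ArithmeticFunction.cardDistinctFactors m : ℝ) - Real.log (Real.log n)
      ≤ x * √(Real.log (Real.log n))} with hA
  have hlog : Tendsto (fun n : ℕ => Real.log n) atTop atTop :=
    Real.tendsto_log_atTop.comp tendsto_natCast_atTop_atTop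
  -- The maximum with 2 keeps σ positive at n = 0 and n = 1.
  set σ : ℕ → ℝ := fun n => 1 / Real.log (max n 2) with hσdef
  have hσ : ∀ n, 0 < σ n := fun n =>
    one_div_pos.mpr (Real.log_pos (lt_max_of_lt_right one_lt_two))
  have hσn : ∀ᶠ n : ℕ in atTop, σ n = 1 / Real.log n := by
    filter_upwards [eventually_ge_atTop 2] with n hn
    simp only [hσdef]
    rw [max_eq_left (by exact_mod_cast hn)]
  have hσ0 : Tendsto σ atTop (𝓝 0) :=
    Tendsto.congr' (hσn.mono fun n hn => hn.symm) (tendsto_const_nhds.div_atTop hlog)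
  have hclt : ∀ j : ℕ, Tendsto (fun n => (zetaLaw (1 + (j + 1) * σ n)).real (A n)) atTop
      (𝓝 ((gaussianReal 0 1).real (Set.Iic x))) := by
    intro j
    have hj : (0 : ℝ) < j + 1 := by positivity
    have hjσ : ∀ n, 0 < (j + 1) * σ n := fun n => mul_pos hj (hσ n)
    refine tendsto_zetaLaw_cardDistinctFactors (fun n => 1 + (j + 1) * σ n) _
      (fun n => by linarith [hjσ n]) (Real.tendsto_log_atTop.comp hlog)
      (|Real.log (j + 1)| + 1) ?_ x
    have h1 := tendsto_mul_zetaSum (fun n => (j + 1) * σ n) hjσ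
      (by simpa using hσ0.const_mul ((j : ℝ) + 1))
    have h2 : Tendsto (fun n => |Real.log ((j + 1) * σ n * zetaSum (1 + (j + 1) * σ n))|) atTop
        (𝓝 0) := by
      simpa using (h1.log one_ne_zero).abs
    filter_upwards [h2.eventually_le_const one_pos, hσn, eventually_ge_atTop 2] with n h3 h4 h5
    have hZ := zetaSum_pos (show 1 < 1 + (j + 1) * σ n by linarith [hjσ n])
    have hl : Real.log (σ n) = -Real.log (Real.log n) := by
      rw [h4, one_div, Real.log_inv]
    rw [Real.log_mul (hjσ n).ne' hZ.ne', Real.log_mul hj.ne' (hσ n).ne', hl] at h3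
    change |Real.log (zetaSum (1 + (j + 1) * σ n)) - Real.log (Real.log n)| ≤ _
    -- Here log ζ(1 + (j+1)σ) = log log n - log(j+1) + o(1); the bracket is the o(1) term.
    have e : Real.log (zetaSum (1 + (j + 1) * σ n)) - Real.log (Real.log n) =
        -Real.log (j + 1) + (Real.log (j + 1) + -Real.log (Real.log n) +
          Real.log (zetaSum (1 + (j + 1) * σ n))) := by ring
    rw [e]
    refine (abs_add_le _ _).trans ?_
    rw [abs_neg]
    linarith
  have huniv : ∀ j : ℕ, Tendsto (fun n => (zetaLaw (1 + (j + 1) * σ n)).real Set.univ) atTop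
      (𝓝 1) := by
    intro j
    refine tendsto_const_nhds.congr fun n => ?_
    have hjσ : 0 < (j + 1) * σ n := mul_pos (by positivity) (hσ n)
    have := isProbabilityMeasure_zetaLaw (show 1 < 1 + (j + 1) * σ n by linarith)
    exact probReal_univ.symm
  have h1 := tendsto_logarithmic_density_of_zetaLaw σ hσ hσn A hclt
  have h2 := tendsto_logarithmic_density_of_zetaLaw σ hσ hσn (fun _ => Set.univ) huniv
  -- Dividing by the case of the full set replaces the normalisation log n by the harmonic sum.
  have h3 := h1.div h2 one_ne_zero
  rw [div_one] at h3
  refine h3.congr' ?_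
  filter_upwards [eventually_ge_atTop 2] with n hn
  have hn1 : (1 : ℝ) < n := by exact_mod_cast hn
  have hlog0 : 1 / Real.log n ≠ 0 := (one_div_pos.mpr (Real.log_pos hn1)).ne'
  rw [Pi.div_apply, mul_div_mul_left _ _ hlog0, zipfMeasure_real_apply, Finset.sum_div]
  refine Finset.sum_congr rfl fun m _ => ?_
  change _ = (A n).indicator (zipfMass 1 n) m
  by_cases hm : m ∈ A n
  · rw [Set.indicator_of_mem hm, Set.indicator_of_mem hm]
    simp [zipfMass, mul_comm, div_eq_mul_inv]
  · rw [Set.indicator_of_notMem hm, Set.indicator_of_notMem hm, zero_div]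

theorem mainTheorem3 :
    (∀ (n : ℕ) [NeZero n],
      Tendsto (fun s : ℝ => zipfDist s n) (𝓝 1) (𝓝 (harmonicDist n))) ∧
    ∃ δ : ℕ → ℝ, (∀ n, 0 < δ n) ∧
      ∀ s : ℕ → ℝ, (∀ᶠ n in atTop, |s n - 1| < δ n) →
        ∀ x : ℝ,
          Tendsto
            (fun n : ℕ => (zipfMeasure (s n) n).real
              {m : ℕ | (ArithmeticFunction.cardDistinctFactors m : ℝ) - Real.log (Real.log n)
                ≤ x * Real.sqrt (Real.log (Real.log n))})
            atTop (𝓝 ((gaussianReal 0 1).real (Set.Iic x))) := by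
  constructor
  · intro n _
    refine ProbabilityMeasure.tendsto_iff_forall_integral_tendsto.mpr fun f => ?_
    change Tendsto (fun s => ∫ m, f m ∂zipfMeasure s n) (𝓝 1) (𝓝 (∫ m, f m ∂harmonicMeasure n))
    rw [harmonicMeasure_eq_zipfMeasure]
    simp only [integral_zipfMeasure]
    exact tendsto_finsetSum _ fun j hj =>
      ((continuous_zipfMass hj).tendsto 1).mul_const (f j)
  -- Any positive null sequence could replace 1/(n+1).
  · have hδ : ∀ n : ℕ, ∃ δ > 0, ∀ s : ℝ, |s - 1| < δ →
        ∑ j ∈ Finset.Icc 1 n, |zipfMass s n j - zipfMass 1 n j| < 1 / ((n : ℝ) + 1) := by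
      intro n
      have hc : Continuous fun s =>
          ∑ j ∈ Finset.Icc 1 n, |zipfMass s n j - zipfMass 1 n j| :=
        continuous_finsetSum _ fun j hj => ((continuous_zipfMass hj).sub continuous_const).abs
      have ht := hc.tendsto 1
      simp only [sub_self, abs_zero, Finset.sum_const_zero] at ht
      obtain ⟨δ, hδ, h⟩ := Metric.eventually_nhds_iff.mp
        (ht.eventually_lt_const (show (0 : ℝ) < 1 / ((n : ℝ) + 1) by positivity))
      exact ⟨δ, hδ, fun s hs => h (by rwa [Real.dist_eq])⟩
    choose δ hδ0 hδ using hδ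
    refine ⟨δ, hδ0, fun s hs x => tendsto_of_tendsto_of_dist
      (tendsto_harmonic_cardDistinctFactors x) ?_⟩
    refine squeeze_zero' (Eventually.of_forall fun _ => dist_nonneg) ?_
      tendsto_one_div_add_atTop_nhds_zero_nat
    filter_upwards [hs] with n hn
    rw [dist_comm, Real.dist_eq]
    exact (abs_zipfMeasure_real_sub_le _ _ _ _).trans (hδ n _ hn).le
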